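/- Let $\kappa\in\mathbb R$ and let $M^2_\kappa$ be the complete simply connected surface of constant curvature $\kappa$ (a round sphere of radius $1/\sqrt\kappa$, the Euclidean plane, or a rescaled hyperbolic plane). Let $T$ be a non-degenerate geodesic triangle in $M^2_\kappa$, that is, three points not lying on a common geodesic line, joined pairwise by minimal geodesic segments; if $\kappa>0$, assume in addition that the three vertices lie in a common open hemisphere. Define the iterated medial subdivisions $T_0,T_1,T_2,\dots$ of $T$ as follows: $T_0$ consists of the single triangle $T$, and $T_{n+1}$ is obtained from $T_n$ by replacing each triangle of $T_n$ by the four triangles into which it is cut by the three minimal geodesic segments joining pairwise the midpoints of its sides. Then there exists $\delta>0$ such that for every $n\ge 0$ every angle of every triangle of $T_n$ lies in the open interval $(\delta,\pi-\delta)$. -/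

import Mathlib

noncomputable section

/-- The model surface `M²_κ` of constant curvature `κ`, as a set: the points
`(x 0, x 1, x 2)` of `ℝ³` with `(x 0)² + ε ((x 1)² + (x 2)²) = 1`, where `ε` is the sign of `κ`,
and `0 < x 0` when `κ ≤ 0`. This is the unit sphere for `κ > 0`, the Euclidean plane
`x 0 = 1` for `κ = 0`, and the upper sheet of the unit hyperboloid for `κ < 0`.
The curvature is made equal to `κ` by the scaling factor in `ModelPlane.dist`. -/
@[ext]
structure ModelPlane (κ : ℝ) where
  /-- the coordinates in `ℝ³` -/
  coords : Fin 3 → ℝ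
  equation : coords 0 ^ 2 + Real.sign κ * (coords 1 ^ 2 + coords 2 ^ 2) = 1
  positive : κ ≤ 0 → 0 < coords 0

namespace ModelPlane

/-- The form `x₀ y₀ + ε (x₁ y₁ + x₂ y₂)`, with `ε` the sign of `κ`. On points it is the cosine of
the angle between them for `κ > 0`, it is `1` for `κ = 0`, and it is minus the Minkowski product
for `κ < 0`. -/
def form (κ : ℝ) (x y : Fin 3 → ℝ) : ℝ :=
  x 0 * y 0 + Real.sign κ * (x 1 * y 1 + x 2 * y 2)

/-- The ambient form `u₁ w₁ + u₂ w₂ + ε u₀ w₀` (Euclidean on `ℝ³` for `κ > 0`, Minkowski for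
`κ < 0`, the inner product of the plane for `κ = 0`). Its restriction to the tangent planes of
the surface is, up to the constant scaling factor, the Riemannian metric. -/
def tangentInner (κ : ℝ) (u w : Fin 3 → ℝ) : ℝ :=
  u 1 * w 1 + u 2 * w 2 + Real.sign κ * (u 0 * w 0)

/-- The geodesic distance of `M²_κ`: the spherical distance divided by `√κ`, the Euclidean
distance, or the hyperbolic distance divided by `√(-κ)`. -/
def dist {κ : ℝ} (p q : ModelPlane κ) : ℝ :=
  if 0 < κ then Real.arccos (form κ p.coords q.coords) / √κ
  else if κ = 0 then
    √((p.coords 1 - q.coords 1) ^ 2 + (p.coords 2 - q.coords 2) ^ 2)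
  else Real.arcosh (form κ p.coords q.coords) / √(-κ)

/-- `m` is a midpoint of a minimal geodesic segment from `p` to `q`. -/
def IsMidpoint {κ : ℝ} (p q m : ModelPlane κ) : Prop :=
  dist p m = dist p q / 2 ∧ dist m q = dist p q / 2

/-- A tangent vector at `p` in the initial direction of the minimal geodesic segment from `p` to
`q`: the projection of `q` to the tangent plane at `p`. For a unit tangent vector `u` the geodesic
with initial vector `u` is `cos t • p + sin t • u`, `p + t • u` or `cosh t • p + sinh t • u`
(according to the sign of `κ`), and the projection of its point at time `t` is
`sin t • u`, `t • u` or `sinh t • u`. -/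
def direction {κ : ℝ} (p q : ModelPlane κ) : Fin 3 → ℝ :=
  q.coords - form κ p.coords q.coords • p.coords

/-- The angle at `p` between the geodesic segments from `p` to `q` and from `p` to `r`. -/
def angle {κ : ℝ} (q p r : ModelPlane κ) : ℝ :=
  Real.arccos (tangentInner κ (direction p q) (direction p r) /
    (√(tangentInner κ (direction p q) (direction p q)) *
      √(tangentInner κ (direction p r) (direction p r))))

set_option maxHeartbeats 1000000 in
/-- Every two points have a midpoint (so the subdivisions below are never empty). -/
theorem exists_isMidpoint {κ : ℝ} (p q : ModelPlane κ) : ∃ m, IsMidpoint p q m := by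
  obtain ⟨x, hx, hx0⟩ := p
  obtain ⟨y, hy, hy0⟩ := q
  rcases lt_trichotomy κ 0 with h | h | h
  · have hn : ¬ 0 < κ := by linarith
    rw [Real.sign_of_neg h] at hx hy
    have hx0 := hx0 h.le
    have hy0 := hy0 h.le
    set b := x 0 * y 0 - (x 1 * y 1 + x 2 * y 2) with hb
    have hb1 : 1 ≤ b := by
      have : x 1 * y 1 + x 2 * y 2 + 1 ≤ x 0 * y 0 := by
        refine le_of_abs_le (abs_le_of_sq_le_sq ?_ (by positivity))
        have e : (x 0 * y 0) ^ 2 = (1 + (x 1 ^ 2 + x 2 ^ 2)) * (1 + (y 1 ^ 2 + y 2 ^ 2)) := by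
          rw [mul_pow]; congr 1 <;> linarith
        rw [e]
        nlinarith [sq_nonneg (x 1 - y 1), sq_nonneg (x 2 - y 2),
          sq_nonneg (x 1 * y 2 - x 2 * y 1)]
      linarith
    set t := √(2 + 2 * b) with ht
    have htp : 0 < t := Real.sqrt_pos.2 (by linarith)
    have ht2 : t ^ 2 = 2 + 2 * b := Real.sq_sqrt (by linarith)
    have hc : Real.cosh (Real.arcosh b / 2) = t / 2 := by
      have h1 := Real.cosh_two_mul (Real.arcosh b / 2)
      have h2 := Real.cosh_sq (Real.arcosh b / 2)
      rw [mul_div_cancel₀ _ two_ne_zero, Real.cosh_arcosh hb1] at h1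
      have h3 := Real.cosh_pos (Real.arcosh b / 2)
      nlinarith
    have ha : Real.arcosh (t / 2) = Real.arcosh b / 2 := by
      rw [← hc, Real.arcosh_cosh (by linarith [Real.arcosh_nonneg hb1])]
    refine ⟨⟨fun i => (x i + y i) / t, ?_, fun _ => by positivity⟩, ?_, ?_⟩
    · rw [Real.sign_of_neg h]
      field_simp
      nlinarith
    · simp only [dist, hn, h.ne, if_false, form, Real.sign_of_neg h]
      rw [show x 0 * ((x 0 + y 0) / t) + -1 * (x 1 * ((x 1 + y 1) / t) + x 2 * ((x 2 + y 2) / t))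
        = t / 2 by field_simp; nlinarith, ha, hb, neg_one_mul, ← sub_eq_add_neg]
      ring
    · simp only [dist, hn, h.ne, if_false, form, Real.sign_of_neg h]
      rw [show (x 0 + y 0) / t * y 0 + -1 * ((x 1 + y 1) / t * y 1 + (x 2 + y 2) / t * y 2)
        = t / 2 by field_simp; nlinarith, ha, hb, neg_one_mul, ← sub_eq_add_neg]
      ring
  · subst h
    simp only [Real.sign_zero, zero_mul, add_zero] at hx hy
    refine ⟨⟨fun i => (x i + y i) / 2, ?_, fun _ => ?_⟩, ?_, ?_⟩
    · have := hx0 le_rfl; have := hy0 le_rfl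
      have h1 : x 0 = 1 := by nlinarith
      have h2 : y 0 = 1 := by nlinarith
      simp [h1, h2]
    · have := hx0 le_rfl; have := hy0 le_rfl
      positivity
    · simp only [dist, lt_irrefl, if_false, if_true]
      rw [show (x 1 - (x 1 + y 1) / 2) ^ 2 + (x 2 - (x 2 + y 2) / 2) ^ 2
        = ((x 1 - y 1) ^ 2 + (x 2 - y 2) ^ 2) / 2 ^ 2 by ring, Real.sqrt_div' _ (by positivity),
        Real.sqrt_sq (by norm_num)]
    · simp only [dist, lt_irrefl, if_false, if_true]
      rw [show ((x 1 + y 1) / 2 - y 1) ^ 2 + ((x 2 + y 2) / 2 - y 2) ^ 2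
        = ((x 1 - y 1) ^ 2 + (x 2 - y 2) ^ 2) / 2 ^ 2 by ring, Real.sqrt_div' _ (by positivity),
        Real.sqrt_sq (by norm_num)]
  · rw [Real.sign_of_pos h, one_mul] at hx hy
    set b := x 0 * y 0 + (x 1 * y 1 + x 2 * y 2) with hb
    have hb1 : b ≤ 1 := by
      nlinarith [sq_nonneg (x 0 - y 0), sq_nonneg (x 1 - y 1), sq_nonneg (x 2 - y 2)]
    have hb2 : -1 ≤ b := by
      nlinarith [sq_nonneg (x 0 + y 0), sq_nonneg (x 1 + y 1), sq_nonneg (x 2 + y 2)]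
    -- it suffices to find a unit vector whose products with both points are the half-angle cosine
    suffices H : ∃ z : Fin 3 → ℝ, z 0 ^ 2 + (z 1 ^ 2 + z 2 ^ 2) = 1 ∧
        x 0 * z 0 + (x 1 * z 1 + x 2 * z 2) = √((1 + b) / 2) ∧
        z 0 * y 0 + (z 1 * y 1 + z 2 * y 2) = √((1 + b) / 2) by
      obtain ⟨z, hz, h1, h2⟩ := H
      have ha : Real.arccos (√((1 + b) / 2)) = Real.arccos b / 2 := by
        have h3 := Real.cos_half (x := Real.arccos b)
          (by linarith [Real.arccos_nonneg b, Real.pi_pos]) (Real.arccos_le_pi b)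
        rw [Real.cos_arccos hb2 hb1] at h3
        rw [← h3, Real.arccos_cos (by linarith [Real.arccos_nonneg b])
          (by linarith [Real.arccos_le_pi b, Real.pi_pos])]
      refine ⟨⟨z, by rw [Real.sign_of_pos h, one_mul, hz], fun h' => by linarith⟩, ?_, ?_⟩
      · simp only [dist, h, if_true, form, Real.sign_of_pos h, one_mul]
        rw [h1, ha, hb]; ring
      · simp only [dist, h, if_true, form, Real.sign_of_pos h, one_mul]
        rw [h2, ha, hb]; ring
    rcases hb2.eq_or_lt with hb3 | hb3
    · have e0 : y 0 = - x 0 := by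
        nlinarith [sq_nonneg (x 0 + y 0), sq_nonneg (x 1 + y 1), sq_nonneg (x 2 + y 2)]
      have e1 : y 1 = - x 1 := by
        nlinarith [sq_nonneg (x 0 + y 0), sq_nonneg (x 1 + y 1), sq_nonneg (x 2 + y 2)]
      have e2 : y 2 = - x 2 := by
        nlinarith [sq_nonneg (x 0 + y 0), sq_nonneg (x 1 + y 1), sq_nonneg (x 2 + y 2)]
      rw [← hb3, e0, e1, e2]
      by_cases h0 : x 0 ^ 2 + x 1 ^ 2 = 0
      · have f0 : x 0 = 0 := by nlinarith [sq_nonneg (x 0), sq_nonneg (x 1)]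
        exact ⟨![1, 0, 0], by simp [f0]⟩
      · have hp : 0 < x 0 ^ 2 + x 1 ^ 2 := lt_of_le_of_ne (by positivity) (Ne.symm h0)
        have hs := Real.sq_sqrt hp.le
        have hs0 := Real.sqrt_pos.2 hp
        set s := √(x 0 ^ 2 + x 1 ^ 2)
        refine ⟨![- x 1 / s, x 0 / s, 0], ?_, ?_, ?_⟩
        · simp; field_simp; linarith
        · simp; ring
        · simp; ring
    · set t := √(2 + 2 * b) with ht
      have htp : 0 < t := Real.sqrt_pos.2 (by linarith)
      have ht2 : t ^ 2 = 2 + 2 * b := Real.sq_sqrt (by linarith)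
      have hs : √((1 + b) / 2) = t / 2 := by
        rw [show (1 + b) / 2 = (t / 2) ^ 2 by nlinarith, Real.sqrt_sq (by positivity)]
      rw [hs]
      refine ⟨fun i => (x i + y i) / t, ?_, ?_, ?_⟩
      · field_simp; nlinarith
      · field_simp; nlinarith
      · field_simp; nlinarith

end ModelPlane

/-- A triple of points of `M²_κ`; in the situations considered here it determines the three
minimal geodesic segments that form the sides. -/
@[ext]
structure GeodesicTriangle (κ : ℝ) where
  A : ModelPlane κ
  B : ModelPlane κ
  C : ModelPlane κ

namespace GeodesicTriangle

open ModelPlane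

/-- The vertices do not lie on a common geodesic line. The geodesic lines (great circles, straight
lines, hyperbolic lines) are the nonempty sections of the surface by planes of `ℝ³` through the
origin (other than `x 0 = 0` for `κ ≤ 0`, which misses the surface). -/
def IsNondegenerate {κ : ℝ} (T : GeodesicTriangle κ) : Prop :=
  LinearIndependent ℝ ![T.A.coords, T.B.coords, T.C.coords]

/-- The vertices lie in a common open hemisphere (meaningful for `κ > 0`): the open ball of radius
`π / (2√κ)` around some point. -/
def InOpenHemisphere {κ : ℝ} (T : GeodesicTriangle κ) : Prop :=
  ∃ c : ModelPlane κ, dist c T.A < Real.pi / (2 * √κ) ∧ dist c T.B < Real.pi / (2 * √κ) ∧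
    dist c T.C < Real.pi / (2 * √κ)

/-- `t` is one of the four triangles into which `T` is cut by joining the midpoints
`X`, `Y`, `Z` of its sides `BC`, `CA`, `AB`. -/
def IsMedialPart {κ : ℝ} (T t : GeodesicTriangle κ) : Prop :=
  ∃ X Y Z : ModelPlane κ, IsMidpoint T.B T.C X ∧ IsMidpoint T.C T.A Y ∧ IsMidpoint T.A T.B Z ∧
    (t = ⟨T.A, Z, Y⟩ ∨ t = ⟨Z, T.B, X⟩ ∨ t = ⟨Y, X, T.C⟩ ∨ t = ⟨X, Y, Z⟩)

/-- The set of triangles of the `n`-th iterated medial subdivision `T_n` of `T`. -/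
def subdivision {κ : ℝ} (T : GeodesicTriangle κ) : ℕ → Set (GeodesicTriangle κ)
  | 0 => {T}
  | n + 1 => {t | ∃ s ∈ subdivision T n, IsMedialPart s t}

/-- `θ` is one of the three interior angles of `t`. -/
def HasAngle {κ : ℝ} (t : GeodesicTriangle κ) (θ : ℝ) : Prop :=
  θ = angle t.B t.A t.C ∨ θ = angle t.C t.B t.A ∨ θ = angle t.A t.C t.B

end GeodesicTriangle

end

namespace ModelPlane

/-! ### The ambient forms and the triple product -/

/-! Central projection to an affine plane `h = 1`, with `h` a linear functional positive at the
vertices, straightens geodesics. The midpoint of `p` and `q` is a positive multiple of `p + q`, so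
its projection is the average of the projections with weights proportional to `h p` and `h q`. On a
bounded region these weights have ratio `1 + O(d)` for points whose projections are at distance at
most `d`. Hence at small scales the subdivision is nearly the affine one, which preserves shapes.

Quantitatively (`IsBounded.isBalanced`), the weights are at least `m = 1 / (2 + K d)`. One step
multiplies the bound `d` on the sides by `1 - m` and areas by at least `2 m³`; for `m = 1/2` these
are the affine factors `1/2` and `1/4`. As `d` decays geometrically, the accumulated distortion of
`area / d²` stays bounded. Instead of an infinite product, the invariant `area ≥ c d² exp (a K d)`
is propagated: the exponential drops as `d` shrinks, and this pays for the distortion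
(`shape_bound_step`, `IsControlled.medialPart`).

By `gram_direction`, the squared sine of an angle is the squared triple product divided by the
squared lengths of the two directions. The invariant bounds the numerator below by a multiple of
`d⁴`, and the denominator is at most a multiple of `d⁴`. -/

theorem abs_sign_le_one (κ : ℝ) : |Real.sign κ| ≤ 1 := by
  rcases Real.sign_apply_eq κ with h | h | h <;> simp [h]

theorem abs_apply_mul_apply_le (x y : Fin 3 → ℝ) (i : Fin 3) : |x i * y i| ≤ ‖x‖ * ‖y‖ := by
  rw [abs_mul]
  exact mul_le_mul (norm_le_pi_norm x i) (norm_le_pi_norm y i) (abs_nonneg _) (norm_nonneg _)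

theorem abs_form_le (κ : ℝ) (x y : Fin 3 → ℝ) : |form κ x y| ≤ 3 * (‖x‖ * ‖y‖) := by
  have h1 : |x 1 * y 1 + x 2 * y 2| ≤ 2 * (‖x‖ * ‖y‖) := by
    linarith [abs_add_le (x 1 * y 1) (x 2 * y 2), abs_apply_mul_apply_le x y 1,
      abs_apply_mul_apply_le x y 2]
  have h2 : |Real.sign κ * (x 1 * y 1 + x 2 * y 2)| ≤ 1 * (2 * (‖x‖ * ‖y‖)) := by
    rw [abs_mul]
    exact mul_le_mul (abs_sign_le_one κ) h1 (abs_nonneg _) zero_le_one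
  unfold form
  linarith [abs_add_le (x 0 * y 0) (Real.sign κ * (x 1 * y 1 + x 2 * y 2)),
    abs_apply_mul_apply_le x y 0]

theorem abs_tangentInner_le (κ : ℝ) (x y : Fin 3 → ℝ) :
    |tangentInner κ x y| ≤ 3 * (‖x‖ * ‖y‖) := by
  have h2 : |Real.sign κ * (x 0 * y 0)| ≤ 1 * (‖x‖ * ‖y‖) := by
    rw [abs_mul]
    exact mul_le_mul (abs_sign_le_one κ) (abs_apply_mul_apply_le x y 0) (abs_nonneg _) zero_le_one
  unfold tangentInner
  linarith [abs_add_le (x 1 * y 1 + x 2 * y 2) (Real.sign κ * (x 0 * y 0)),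
    abs_add_le (x 1 * y 1) (x 2 * y 2), abs_apply_mul_apply_le x y 1,
    abs_apply_mul_apply_le x y 2]

theorem form_self {κ : ℝ} (p : ModelPlane κ) : form κ p.coords p.coords = 1 := by
  have := p.equation
  simp only [form]
  linarith

theorem form_smul_smul (κ a b : ℝ) (x y : Fin 3 → ℝ) :
    form κ (a • x) (b • y) = a * b * form κ x y := by
  simp only [form, Pi.smul_apply, smul_eq_mul]
  ring

/-- The determinant of three vectors of `ℝ³`. -/
def tripleProduct (x y z : Fin 3 → ℝ) : ℝ :=
  x 0 * (y 1 * z 2 - y 2 * z 1) - x 1 * (y 0 * z 2 - y 2 * z 0) + x 2 * (y 0 * z 1 - y 1 * z 0)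

theorem tripleProduct_rotate (x y z : Fin 3 → ℝ) :
    tripleProduct y z x = tripleProduct x y z := by
  simp only [tripleProduct]
  ring

theorem tripleProduct_smul (a b c : ℝ) (x y z : Fin 3 → ℝ) :
    tripleProduct (a • x) (b • y) (c • z) = a * b * c * tripleProduct x y z := by
  simp only [tripleProduct, Pi.smul_apply, smul_eq_mul]
  ring

theorem tripleProduct_ne_zero {x y z : Fin 3 → ℝ} (h : LinearIndependent ℝ ![x, y, z]) :
    tripleProduct x y z ≠ 0 := by
  have h1 : IsUnit (Matrix.of ![x, y, z]) := Matrix.linearIndependent_rows_iff_isUnit.1 h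
  rw [Matrix.isUnit_iff_isUnit_det, isUnit_iff_ne_zero, Matrix.det_fin_three] at h1
  convert h1 using 1
  simp [tripleProduct]
  ring

/-! ### Midpoints -/

theorem one_le_form_of_neg {κ : ℝ} (h : κ < 0) (p q : ModelPlane κ) :
    1 ≤ form κ p.coords q.coords := by
  obtain ⟨x, hx, hx0⟩ := p
  obtain ⟨y, hy, hy0⟩ := q
  have hx0 := hx0 h.le
  have hy0 := hy0 h.le
  simp only [form]
  rw [Real.sign_of_neg h] at hx hy ⊢
  have : x 1 * y 1 + x 2 * y 2 + 1 ≤ x 0 * y 0 := by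
    refine le_of_abs_le (abs_le_of_sq_le_sq ?_ (by positivity))
    have e : (x 0 * y 0) ^ 2 = (1 + (x 1 ^ 2 + x 2 ^ 2)) * (1 + (y 1 ^ 2 + y 2 ^ 2)) := by
      rw [mul_pow]; congr 1 <;> linarith
    rw [e]
    nlinarith [sq_nonneg (x 1 - y 1), sq_nonneg (x 2 - y 2),
      sq_nonneg (x 1 * y 2 - x 2 * y 1)]
  linarith

theorem coords_zero_eq_one (p : ModelPlane 0) : p.coords 0 = 1 := by
  have h1 := p.equation
  have h2 := p.positive le_rfl
  rw [Real.sign_zero, zero_mul, add_zero] at h1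
  nlinarith

theorem form_zero (p q : ModelPlane 0) : form 0 p.coords q.coords = 1 := by
  simp [form, coords_zero_eq_one]

theorem one_le_form_of_nonpos {κ : ℝ} (h : κ ≤ 0) (p q : ModelPlane κ) :
    1 ≤ form κ p.coords q.coords := by
  rcases h.lt_or_eq with h | rfl
  · exact one_le_form_of_neg h p q
  · exact (form_zero p q).ge

theorem abs_form_le_one_of_pos {κ : ℝ} (h : 0 < κ) (p q : ModelPlane κ) :
    |form κ p.coords q.coords| ≤ 1 := by
  have hx := p.equation
  have hy := q.equation
  simp only [form]
  rw [Real.sign_of_pos h] at hx hy ⊢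
  rw [abs_le]
  constructor
  · nlinarith [sq_nonneg (p.coords 0 + q.coords 0), sq_nonneg (p.coords 1 + q.coords 1),
      sq_nonneg (p.coords 2 + q.coords 2)]
  · nlinarith [sq_nonneg (p.coords 0 - q.coords 0), sq_nonneg (p.coords 1 - q.coords 1),
      sq_nonneg (p.coords 2 - q.coords 2)]

theorem coords_eq_neg_of_form_eq_neg_one {κ : ℝ} (h : 0 < κ) {p q : ModelPlane κ}
    (hpq : form κ p.coords q.coords = -1) : q.coords = -p.coords := by
  have hx := p.equation
  have hy := q.equation
  simp only [form] at hpq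
  rw [Real.sign_of_pos h] at hx hy hpq
  have h0 := sq_nonneg (p.coords 0 + q.coords 0)
  have h1 := sq_nonneg (p.coords 1 + q.coords 1)
  have h2 := sq_nonneg (p.coords 2 + q.coords 2)
  ext i
  fin_cases i <;> simp <;> nlinarith

/-- Antipodal points cannot both lie on the positive side of a plane through the origin. This
excludes the one case where midpoints are not unique. -/
theorem neg_one_lt_form {κ : ℝ} {p q : ModelPlane κ} (h : (Fin 3 → ℝ) →ₗ[ℝ] ℝ)
    (hp : 0 < h p.coords) (hq : 0 < h q.coords) : -1 < form κ p.coords q.coords := by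
  rcases le_or_gt κ 0 with hκ | hκ
  · linarith [one_le_form_of_nonpos hκ p q]
  · refine lt_of_le_of_ne (abs_le.1 (abs_form_le_one_of_pos hκ p q)).1 fun he => ?_
    rw [coords_eq_neg_of_form_eq_neg_one hκ he.symm, map_neg] at hq
    linarith

/-- A vector with the same norm and the same products with `p` and `q` as the normalized sum
of `p` and `q` is this normalized sum. -/
theorem coords_eq_of_form_eq {κ : ℝ} (hκ : κ ≠ 0) {p q m : ModelPlane κ} {t : ℝ} (ht : 0 < t)
    (ht2 : t ^ 2 = 2 + 2 * form κ p.coords q.coords)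
    (h1 : form κ p.coords m.coords = t / 2) (h2 : form κ m.coords q.coords = t / 2) :
    m.coords = t⁻¹ • (p.coords + q.coords) := by
  obtain ⟨x, hx, hx0⟩ := p
  obtain ⟨y, hy, hy0⟩ := q
  obtain ⟨z, hz, hz0⟩ := m
  simp only [form] at ht2 h1 h2 ⊢
  -- Both `w` and `z` have square 1 and their product is 1: the equality case of the Cauchy–Schwarz
  -- inequality, reversed for `κ < 0`.
  set w : Fin 3 → ℝ := t⁻¹ • (x + y) with hw
  have w' : ∀ i, t * w i = x i + y i := fun i => by simp [hw]; field_simp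
  have hwz : w 0 * z 0 + Real.sign κ * (w 1 * z 1 + w 2 * z 2) = 1 := by
    refine mul_left_cancel₀ ht.ne' ?_
    linear_combination z 0 * w' 0 + Real.sign κ * (z 1 * w' 1 + z 2 * w' 2) + h1 + h2
  have hww : w 0 ^ 2 + Real.sign κ * (w 1 ^ 2 + w 2 ^ 2) = 1 := by
    refine mul_left_cancel₀ (pow_pos ht 2).ne' ?_
    have e : t ^ 2 * (w 0 ^ 2 + Real.sign κ * (w 1 ^ 2 + w 2 ^ 2)) =
        (t * w 0) ^ 2 + Real.sign κ * ((t * w 1) ^ 2 + (t * w 2) ^ 2) := by ring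
    rw [e, w' 0, w' 1, w' 2]
    linear_combination hx + hy - ht2
  rcases lt_or_gt_of_ne hκ with h | h
  · rw [Real.sign_of_neg h] at hz hww hwz
    have e : (w 1 - z 1) ^ 2 + (w 2 - z 2) ^ 2 + (w 1 * z 2 - w 2 * z 1) ^ 2 = 0 := by
      have e1 : w 0 * z 0 = 1 + (w 1 * z 1 + w 2 * z 2) := by linarith
      have e2 : (w 0 ^ 2) * (z 0 ^ 2) = (1 + (w 1 * z 1 + w 2 * z 2)) ^ 2 := by rw [← e1]; ring
      rw [show w 0 ^ 2 = 1 + (w 1 ^ 2 + w 2 ^ 2) by linarith,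
        show z 0 ^ 2 = 1 + (z 1 ^ 2 + z 2 ^ 2) by linarith] at e2
      linear_combination e2
    have n1 := sq_nonneg (w 1 - z 1)
    have n2 := sq_nonneg (w 2 - z 2)
    have n3 := sq_nonneg (w 1 * z 2 - w 2 * z 1)
    have e1 : z 1 = w 1 := by
      have : (w 1 - z 1) ^ 2 = 0 := by linarith
      linarith [pow_eq_zero_iff (two_ne_zero) |>.1 this]
    have e2 : z 2 = w 2 := by
      have : (w 2 - z 2) ^ 2 = 0 := by linarith
      linarith [pow_eq_zero_iff (two_ne_zero) |>.1 this]
    have e0 : z 0 = w 0 := by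
      have hz0 := hz0 h.le
      have hw0 : 0 < w 0 := by
        have := w' 0
        have := hx0 h.le
        have := hy0 h.le
        by_contra hcon
        nlinarith
      rw [e1, e2] at hz
      nlinarith
    ext i
    fin_cases i
    · exact e0
    · exact e1
    · exact e2
  · rw [Real.sign_of_pos h] at hz hww hwz
    have n0 := sq_nonneg (w 0 - z 0)
    have n1 := sq_nonneg (w 1 - z 1)
    have n2 := sq_nonneg (w 2 - z 2)
    have e : (w 0 - z 0) ^ 2 + (w 1 - z 1) ^ 2 + (w 2 - z 2) ^ 2 = 0 := by
      linear_combination hz + hww - 2 * hwz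
    have e0 : (w 0 - z 0) ^ 2 = 0 := by linarith
    have e1 : (w 1 - z 1) ^ 2 = 0 := by linarith
    have e2 : (w 2 - z 2) ^ 2 = 0 := by linarith
    ext i
    fin_cases i
    · exact (sub_eq_zero.1 ((pow_eq_zero_iff two_ne_zero).1 e0)).symm
    · exact (sub_eq_zero.1 ((pow_eq_zero_iff two_ne_zero).1 e1)).symm
    · exact (sub_eq_zero.1 ((pow_eq_zero_iff two_ne_zero).1 e2)).symm

theorem form_eq_of_arcosh_eq {κ : ℝ} (h : κ < 0) {p q : ModelPlane κ} {b : ℝ} (hb : 1 ≤ b)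
    (he : Real.arcosh (form κ p.coords q.coords) = Real.arcosh b / 2) :
    form κ p.coords q.coords = √(2 + 2 * b) / 2 := by
  have h1 := Real.cosh_two_mul (Real.arcosh b / 2)
  have h2 := Real.cosh_sq (Real.arcosh b / 2)
  rw [mul_div_cancel₀ _ two_ne_zero, Real.cosh_arcosh hb] at h1
  have h3 := Real.cosh_pos (Real.arcosh b / 2)
  rw [← he, Real.cosh_arcosh (one_le_form_of_neg h p q)] at h1 h2 h3
  rw [show 2 + 2 * b = (2 * form κ p.coords q.coords) ^ 2 by linarith,
    Real.sqrt_sq (by linarith)]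
  ring

theorem form_eq_of_arccos_eq {κ : ℝ} (h : 0 < κ) {p q : ModelPlane κ} {b : ℝ} (hb : |b| ≤ 1)
    (he : Real.arccos (form κ p.coords q.coords) = Real.arccos b / 2) :
    form κ p.coords q.coords = √(2 + 2 * b) / 2 := by
  have hf := abs_le.1 (abs_form_le_one_of_pos h p q)
  have hb := abs_le.1 hb
  have h3 := Real.cos_half (x := Real.arccos b)
    (by linarith [Real.arccos_nonneg b, Real.pi_pos]) (Real.arccos_le_pi b)
  rw [Real.cos_arccos hb.1 hb.2, ← he, Real.cos_arccos hf.1 hf.2] at h3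
  rw [h3, show 2 + 2 * b = (1 + b) / 2 * 2 ^ 2 by ring, Real.sqrt_mul' _ (by positivity),
    Real.sqrt_sq (by norm_num)]
  ring

/-- For `κ ≠ 0` the half-angle formulas give the products of `m` with `p` and `q`, and these
determine `m`. Linearity in the endpoints up to scale is what makes midpoints weighted averages
after central projection. -/
theorem IsMidpoint.coords_eq {κ : ℝ} {p q m : ModelPlane κ} (hm : IsMidpoint p q m)
    (hpq : -1 < form κ p.coords q.coords) :
    m.coords = (√(2 + 2 * form κ p.coords q.coords))⁻¹ • (p.coords + q.coords) := by
  have ht : 0 < √(2 + 2 * form κ p.coords q.coords) := Real.sqrt_pos.2 (by linarith)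
  have ht2 := Real.sq_sqrt (show 0 ≤ 2 + 2 * form κ p.coords q.coords by linarith)
  obtain ⟨h1, h2⟩ := hm
  simp only [dist] at h1 h2
  rcases lt_trichotomy κ 0 with h | rfl | h
  · have hs : 0 < √(-κ) := Real.sqrt_pos.2 (by linarith)
    simp only [h.not_gt, h.ne, if_false] at h1 h2
    rw [div_right_comm, div_left_inj' hs.ne'] at h1 h2
    have hb := one_le_form_of_neg h p q
    exact coords_eq_of_form_eq h.ne ht ht2 (form_eq_of_arcosh_eq h hb h1)
      (form_eq_of_arcosh_eq h hb h2)
  · simp only [lt_irrefl, if_false, if_true] at h1 h2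
    set x := p.coords with hx
    set y := q.coords with hy
    set z := m.coords with hz
    rw [form_zero, show (2 + 2 * 1 : ℝ) = 2 ^ 2 by norm_num, Real.sqrt_sq (by norm_num)]
    have e1 := Real.sq_sqrt (show 0 ≤ (x 1 - z 1) ^ 2 + (x 2 - z 2) ^ 2 by positivity)
    have e2 := Real.sq_sqrt (show 0 ≤ (z 1 - y 1) ^ 2 + (z 2 - y 2) ^ 2 by positivity)
    have e3 := Real.sq_sqrt (show 0 ≤ (x 1 - y 1) ^ 2 + (x 2 - y 2) ^ 2 by positivity)
    rw [h1, div_pow, e3] at e1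
    rw [h2, div_pow, e3] at e2
    have n1 := sq_nonneg (2 * z 1 - x 1 - y 1)
    have n2 := sq_nonneg (2 * z 2 - x 2 - y 2)
    -- For `κ = 0` the form is constant on points and carries no information; the parallelogram law
    -- for the distances replaces it.
    have e : (2 * z 1 - x 1 - y 1) ^ 2 + (2 * z 2 - x 2 - y 2) ^ 2 = 0 := by
      linear_combination (-2) * e1 - 2 * e2
    have f1 : (2 * z 1 - x 1 - y 1) ^ 2 = 0 := by linarith
    have f2 : (2 * z 2 - x 2 - y 2) ^ 2 = 0 := by linarith
    have g1 := (pow_eq_zero_iff two_ne_zero).1 f1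
    have g2 := (pow_eq_zero_iff two_ne_zero).1 f2
    ext i
    fin_cases i
    · simp [hx, hy, hz, coords_zero_eq_one]; norm_num
    · simp; linarith
    · simp; linarith
  · have hs : 0 < √κ := Real.sqrt_pos.2 h
    simp only [h, if_true] at h1 h2
    rw [div_right_comm, div_left_inj' hs.ne'] at h1 h2
    have hb := abs_form_le_one_of_pos h p q
    exact coords_eq_of_form_eq h.ne' ht ht2 (form_eq_of_arccos_eq h hb h1)
      (form_eq_of_arccos_eq h hb h2)

end ModelPlane

namespace ModelPlane

/-! ### Weighted subdivision in a vector space -/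

/-- `z` divides the segment from `p` to `q` in a ratio with both weights at least `m`. -/
def IsBalanced (m : ℝ) (z p q : Fin 3 → ℝ) : Prop :=
  ∃ l : ℝ, m ≤ l ∧ l ≤ 1 - m ∧ z = (1 - l) • p + l • q

theorem IsBalanced.symm {m : ℝ} {z p q : Fin 3 → ℝ} (h : IsBalanced m z p q) :
    IsBalanced m z q p := by
  obtain ⟨l, h1, h2, h3⟩ := h
  refine ⟨1 - l, by linarith, by linarith, ?_⟩
  rw [h3, sub_sub_cancel, add_comm]

theorem IsBalanced.norm_le {m R : ℝ} {z p q : Fin 3 → ℝ} (hm : 0 ≤ m) (h : IsBalanced m z p q)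
    (hp : ‖p‖ ≤ R) (hq : ‖q‖ ≤ R) : ‖z‖ ≤ R := by
  obtain ⟨l, h1, h2, rfl⟩ := h
  calc ‖(1 - l) • p + l • q‖ ≤ (1 - l) * ‖p‖ + l * ‖q‖ := by
        refine (norm_add_le _ _).trans_eq ?_
        rw [norm_smul, norm_smul, Real.norm_of_nonneg (by linarith), Real.norm_of_nonneg (by linarith)]
    _ ≤ (1 - l) * R + l * R := by
        have : 0 ≤ 1 - l := by linarith
        have : 0 ≤ l := by linarith
        gcongr
    _ = R := by ring

theorem IsBalanced.norm_sub_left_le {m d : ℝ} {z p q : Fin 3 → ℝ} (hm : 0 ≤ m)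
    (h : IsBalanced m z p q) (hpq : ‖p - q‖ ≤ d) : ‖p - z‖ ≤ (1 - m) * d := by
  obtain ⟨l, h1, h2, rfl⟩ := h
  rw [show p - ((1 - l) • p + l • q) = l • (p - q) by module, norm_smul,
    Real.norm_of_nonneg (by linarith)]
  exact mul_le_mul h2 hpq (norm_nonneg _) (by linarith)

/-- For `l ≤ k` the difference is `(k - l) • (p - r) + l • (q - r)`, whose nonnegative coefficients
add up to `k ≤ 1 - m`. -/
theorem norm_combination_sub_le {m d l k : ℝ} {p q r : Fin 3 → ℝ} (hm : 0 ≤ m) (hl : m ≤ l)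
    (hk : k ≤ 1 - m) (hlk : l ≤ k) (hpr : ‖p - r‖ ≤ d) (hqr : ‖q - r‖ ≤ d) :
    ‖((1 - l) • p + l • q) - ((1 - k) • p + k • r)‖ ≤ (1 - m) * d := by
  have hd : 0 ≤ d := (norm_nonneg _).trans hpr
  rw [show ((1 - l) • p + l • q) - ((1 - k) • p + k • r) = (k - l) • (p - r) + l • (q - r) by module]
  calc ‖(k - l) • (p - r) + l • (q - r)‖ ≤ (k - l) * ‖p - r‖ + l * ‖q - r‖ := by
        refine (norm_add_le _ _).trans_eq ?_
        rw [norm_smul, norm_smul, Real.norm_of_nonneg (by linarith), Real.norm_of_nonneg (by linarith)]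
    _ ≤ (k - l) * d + l * d := by
        have : 0 ≤ k - l := by linarith
        have : 0 ≤ l := by linarith
        gcongr
    _ = k * d := by ring
    _ ≤ (1 - m) * d := by gcongr

theorem IsBalanced.norm_sub_le {m d : ℝ} {z y p q r : Fin 3 → ℝ} (hm : 0 ≤ m)
    (hz : IsBalanced m z p q) (hy : IsBalanced m y p r) (hpq : ‖p - q‖ ≤ d) (hpr : ‖p - r‖ ≤ d)
    (hqr : ‖q - r‖ ≤ d) : ‖z - y‖ ≤ (1 - m) * d := by
  obtain ⟨l, hl, hl', rfl⟩ := hz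
  obtain ⟨k, hk, hk', rfl⟩ := hy
  rcases le_total l k with hlk | hlk
  · exact norm_combination_sub_le hm hl hk' hlk hpr hqr
  · rw [norm_sub_rev]
    exact norm_combination_sub_le hm hk hl' hlk hpq (by rwa [norm_sub_rev])

/-- A corner part has area factor `l k ≥ m²`. Weakening this to `2 m³` gives one factor for all four
parts and loses nothing at `m = 1/2`. -/
theorem two_mul_cube_le_mul {m l k : ℝ} (hm : 0 ≤ m) (hm' : m ≤ 1 / 2) (hl : m ≤ l) (hk : m ≤ k) :
    2 * m ^ 3 ≤ l * k := by
  calc 2 * m ^ 3 = (2 * m) * (m * m) := by ring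
    _ ≤ 1 * (m * m) := by gcongr; linarith
    _ ≤ l * k := by rw [one_mul]; exact mul_le_mul hl hk hm (hm.trans hl)

theorem IsBalanced.abs_tripleProduct_corner {m : ℝ} {z y p q r : Fin 3 → ℝ} (hm : 0 ≤ m)
    (hm' : m ≤ 1 / 2) (hz : IsBalanced m z p q) (hy : IsBalanced m y p r) :
    2 * m ^ 3 * |tripleProduct p q r| ≤ |tripleProduct p z y| := by
  obtain ⟨l, hl, hl', rfl⟩ := hz
  obtain ⟨k, hk, hk', rfl⟩ := hy
  have e : tripleProduct p ((1 - l) • p + l • q) ((1 - k) • p + k • r) =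
      l * k * tripleProduct p q r := by
    simp only [tripleProduct, Pi.smul_apply, Pi.add_apply, smul_eq_mul]
    ring
  have hlk := two_mul_cube_le_mul hm hm' hl hk
  rw [e, abs_mul, abs_of_nonneg (le_trans (by positivity) hlk)]
  gcongr

/-- The matrix of weights has zero diagonal, so its determinant consists of the two cyclic terms,
each at least `m³`. -/
theorem IsBalanced.abs_tripleProduct_center {m : ℝ} {x y z p q r : Fin 3 → ℝ} (hm : 0 ≤ m)
    (hx : IsBalanced m x q r) (hy : IsBalanced m y r p) (hz : IsBalanced m z p q) :
    2 * m ^ 3 * |tripleProduct p q r| ≤ |tripleProduct x y z| := by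
  obtain ⟨i, hi, hi', rfl⟩ := hx
  obtain ⟨j, hj, hj', rfl⟩ := hy
  obtain ⟨k, hk, hk', rfl⟩ := hz
  have e : tripleProduct ((1 - i) • q + i • r) ((1 - j) • r + j • p) ((1 - k) • p + k • q) =
      ((1 - i) * (1 - j) * (1 - k) + i * j * k) * tripleProduct p q r := by
    simp only [tripleProduct, Pi.smul_apply, Pi.add_apply, smul_eq_mul]
    ring
  have h1 : m * m * m ≤ (1 - i) * (1 - j) * (1 - k) := by
    have : 0 ≤ 1 - i := by linarith
    have : 0 ≤ 1 - j := by linarith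
    have : 0 ≤ 1 - k := by linarith
    gcongr <;> linarith
  have h2 : m * m * m ≤ i * j * k := by
    have : 0 ≤ i := by linarith
    have : 0 ≤ j := by linarith
    gcongr
  have h3 : 2 * m ^ 3 ≤ (1 - i) * (1 - j) * (1 - k) + i * j * k := by
    linear_combination h1 + h2
  rw [e, abs_mul, abs_of_nonneg (le_trans (by positivity) h3)]
  gcongr

/-- The lower bound `c d² exp (a K d)` for the area of a triangle of diameter at most `d` survives
a subdivision step that shrinks `d` by the factor `1 - m` and areas by the factor `2 m³` at most,
where `m = 1 / (2 + K d)`. -/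
theorem shape_bound_step {K c d d₀ : ℝ} (hK : 0 ≤ K) (hc : 0 ≤ c) (hd : 0 < d) (hd₀ : d ≤ d₀) :
    c * ((1 - 1 / (2 + K * d)) * d) ^ 2 *
        Real.exp (3 * (2 + K * d₀) * (K * ((1 - 1 / (2 + K * d)) * d))) ≤
      2 * (1 / (2 + K * d)) ^ 3 * (c * d ^ 2 * Real.exp (3 * (2 + K * d₀) * (K * d))) := by
  set u := K * d with hu
  have hu0 : 0 ≤ u := by positivity
  have hu1 : u ≤ K * d₀ := by rw [hu]; gcongr
  set m := 1 / (2 + u) with hm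
  have hm0 : 0 < m := by positivity
  have hmu : m * (2 + u) = 1 := by rw [hm]; field_simp
  have h1m : 1 - m = m * (1 + u) := by linarith
  set v := 3 * (2 + K * d₀) * (K * ((1 - m) * d)) with hv
  -- As `2 + K d₀ ≥ 2 + u = 1 / m`, the exponent drops by at least `3 u`.
  have h3 : v + 3 * u ≤ 3 * (2 + K * d₀) * u := by
    have : 1 ≤ (2 + K * d₀) * m := by
      calc 1 = (2 + u) * m := by linarith
        _ ≤ _ := by gcongr
    have : 0 ≤ ((2 + K * d₀) * m - 1) * u := mul_nonneg (by linarith) hu0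
    have e : v = 3 * (2 + K * d₀) * ((1 - m) * u) := by rw [hv, hu]; ring
    rw [e]
    linarith
  have h4 : (1 + u) ^ 3 ≤ Real.exp (3 * u) := by
    rw [show 3 * u = (3 : ℕ) * u by norm_num, Real.exp_nat_mul]
    gcongr
    linarith [Real.add_one_le_exp u]
  have h5 : Real.exp v * (1 + u) ^ 3 ≤ Real.exp (3 * (2 + K * d₀) * u) := by
    calc Real.exp v * (1 + u) ^ 3 ≤ Real.exp v * Real.exp (3 * u) := by gcongr
      _ = Real.exp (v + 3 * u) := (Real.exp_add _ _).symm
      _ ≤ _ := Real.exp_le_exp.2 h3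
  -- With `1 - m = m (1 + u)`, what is needed is `(1 + u)² ≤ 2 m exp (3 u)`; this inequality reduces
  -- it to `(1 + u)³ ≤ exp (3 u)`, whence the coefficient 3.
  have h6 : 1 ≤ 2 * m * (1 + u) := by nlinarith
  calc c * ((1 - m) * d) ^ 2 * Real.exp v
      = (c * d ^ 2 * m ^ 2 * Real.exp v * (1 + u) ^ 2) * 1 := by rw [h1m]; ring
    _ ≤ (c * d ^ 2 * m ^ 2 * Real.exp v * (1 + u) ^ 2) * (2 * m * (1 + u)) := by gcongr
    _ = 2 * m ^ 3 * (c * d ^ 2 * (Real.exp v * (1 + u) ^ 3)) := by ring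
    _ ≤ _ := by gcongr

/-! ### The central projection to an affine plane -/

/-- The central projection of `p` to the affine plane `h = 1`. -/
noncomputable def chart {κ : ℝ} (h : (Fin 3 → ℝ) →ₗ[ℝ] ℝ) (p : ModelPlane κ) : Fin 3 → ℝ :=
  (h p.coords)⁻¹ • p.coords

theorem smul_chart {κ : ℝ} {h : (Fin 3 → ℝ) →ₗ[ℝ] ℝ} {p : ModelPlane κ} (hp : 0 < h p.coords) :
    h p.coords • chart h p = p.coords := by
  rw [chart, smul_inv_smul₀ hp.ne']

theorem sq_mul_form_chart {κ : ℝ} {h : (Fin 3 → ℝ) →ₗ[ℝ] ℝ} {p : ModelPlane κ}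
    (hp : 0 < h p.coords) : h p.coords ^ 2 * form κ (chart h p) (chart h p) = 1 := by
  rw [sq, ← form_smul_smul, smul_chart hp, form_self]

/-- `p` projects into the ball of radius `R` of the plane `h = 1`, and `h ≤ H` at `p`. -/
structure IsBounded {κ : ℝ} (h : (Fin 3 → ℝ) →ₗ[ℝ] ℝ) (H R : ℝ) (p : ModelPlane κ) : Prop where
  pos : 0 < h p.coords
  le : h p.coords ≤ H
  norm_le : ‖chart h p‖ ≤ R

/-- The form of the projected point with itself is `1 / h²` and is at most `3 R²`, so `h` is bounded
below in terms of `R` alone. -/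
theorem IsBounded.one_le {κ H R : ℝ} {h : (Fin 3 → ℝ) →ₗ[ℝ] ℝ} {p : ModelPlane κ}
    (hp : IsBounded h H R p) : 1 ≤ 3 * R ^ 2 * h p.coords ^ 2 := by
  have h1 := le_of_abs_le (abs_form_le κ (chart h p) (chart h p))
  have h2 : ‖chart h p‖ * ‖chart h p‖ ≤ R * R :=
    mul_self_le_mul_self (norm_nonneg _) hp.norm_le
  have h3 := sq_mul_form_chart hp.pos
  have h4 : 0 < h p.coords ^ 2 := pow_pos hp.pos 2
  nlinarith

/-- The projected point determines `h`, since `h⁻²` is its form with itself. That quadratic function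
has Lipschitz constant `6 R` on the ball, so nearby points have nearly equal weights. -/
theorem IsBounded.div_le {κ H R d : ℝ} {h : (Fin 3 → ℝ) →ₗ[ℝ] ℝ} {p q : ModelPlane κ}
    (hp : IsBounded h H R p) (hq : IsBounded h H R q) (hpq : ‖chart h p - chart h q‖ ≤ d) :
    h p.coords ≤ (1 + 6 * R * H ^ 2 * d) * h q.coords := by
  set a := chart h p with ha
  set b := chart h q with hb
  set x := h p.coords with hx
  set y := h q.coords with hy
  have hx0 : 0 < x := hp.pos
  have hy0 : 0 < y := hq.pos
  have hR : 0 ≤ R := (norm_nonneg _).trans hp.norm_le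
  have hd : 0 ≤ d := (norm_nonneg _).trans hpq
  have h1 : x ^ 2 * form κ a a = 1 := sq_mul_form_chart hp.pos
  have h2 : y ^ 2 * form κ b b = 1 := sq_mul_form_chart hq.pos
  have h3 : form κ b b - form κ a a ≤ 6 * R * d := by
    have e : form κ b b - form κ a a = form κ (b - a) (b + a) := by
      simp only [form, Pi.sub_apply, Pi.add_apply]
      ring
    rw [e]
    refine (le_of_abs_le (abs_form_le κ _ _)).trans ?_
    have : ‖b - a‖ * ‖b + a‖ ≤ d * (R + R) := by
      refine mul_le_mul (by rwa [norm_sub_rev]) ?_ (norm_nonneg _) hd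
      exact (norm_add_le _ _).trans (add_le_add hq.norm_le hp.norm_le)
    linarith
  have h4 : x ^ 2 - y ^ 2 ≤ H ^ 2 * y ^ 2 * (6 * R * d) := by
    calc x ^ 2 - y ^ 2 = x ^ 2 * y ^ 2 * (form κ b b - form κ a a) := by
          linear_combination (-x ^ 2) * h2 + y ^ 2 * h1
      _ ≤ x ^ 2 * y ^ 2 * (6 * R * d) := by gcongr
      _ ≤ H ^ 2 * y ^ 2 * (6 * R * d) := by
          have := hp.le
          gcongr
  set K := 6 * R * H ^ 2 * d with hK
  have hK0 : 0 ≤ K := by positivity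
  have h5 : x ^ 2 ≤ ((1 + K) * y) ^ 2 := by
    have : x ^ 2 ≤ (1 + K) * y ^ 2 := by rw [hK]; linarith
    refine this.trans ?_
    rw [mul_pow]
    gcongr
    nlinarith
  exact le_of_sq_le_sq h5 (by positivity)

theorem IsBounded.isBalanced {κ H R d : ℝ} {h : (Fin 3 → ℝ) →ₗ[ℝ] ℝ} {p q m : ModelPlane κ}
    (hp : IsBounded h H R p) (hq : IsBounded h H R q) (hpq : ‖chart h p - chart h q‖ ≤ d)
    (hm : IsMidpoint p q m) :
    0 < h m.coords ∧ IsBalanced (1 / (2 + 6 * R * H ^ 2 * d)) (chart h m) (chart h p) (chart h q) := by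
  have hf := neg_one_lt_form h hp.pos hq.pos
  have hm' := hm.coords_eq hf
  set t := √(2 + 2 * form κ p.coords q.coords)
  have ht : 0 < t := Real.sqrt_pos.2 (by linarith)
  have hR : 0 ≤ R := (norm_nonneg _).trans hp.norm_le
  have hd : 0 ≤ d := (norm_nonneg _).trans hpq
  have h1 := hp.div_le hq hpq
  have h2 := hq.div_le hp (d := d) (by rwa [norm_sub_rev])
  have hx : 0 < h p.coords := hp.pos
  have hy : 0 < h q.coords := hq.pos
  set x := h p.coords with hxdef
  set y := h q.coords with hydef
  have hhm : h m.coords = t⁻¹ * (x + y) := by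
    rw [hm', map_smul, map_add, smul_eq_mul]
  have hK : 0 < 2 + 6 * R * H ^ 2 * d := by positivity
  have hxy : 0 < x + y := by positivity
  refine ⟨by rw [hhm]; positivity, y / (x + y), ?_, ?_, ?_⟩
  · rw [div_le_div_iff₀ hK hxy]
    linarith
  · rw [show y / (x + y) = 1 - x / (x + y) by field_simp; ring]
    refine sub_le_sub_left ?_ _
    rw [div_le_div_iff₀ hK hxy]
    linarith
  · rw [chart, chart, chart, ← hxdef, ← hydef, hhm, hm', smul_smul, smul_smul, smul_smul,
      show (t⁻¹ * (x + y))⁻¹ * t⁻¹ = (x + y)⁻¹ by field_simp,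
      show (1 - y / (x + y)) * x⁻¹ = (x + y)⁻¹ by field_simp; ring,
      show y / (x + y) * y⁻¹ = (x + y)⁻¹ by field_simp, smul_add]

end ModelPlane

namespace ModelPlane

/-! ### Angles -/

theorem tangentInner_direction {κ : ℝ} (hκ : κ ≠ 0) (p q r : ModelPlane κ) :
    tangentInner κ (direction p q) (direction p r) =
      Real.sign κ * (form κ q.coords r.coords -
        form κ p.coords q.coords * form κ p.coords r.coords) := by
  have hp := form_self p
  have hs : Real.sign κ * Real.sign κ = 1 := by
    rcases lt_or_gt_of_ne hκ with h | h
    · simp [Real.sign_of_neg h]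
    · simp [Real.sign_of_pos h]
  have e : ∀ u w : Fin 3 → ℝ, tangentInner κ u w = Real.sign κ * form κ u w := by
    intro u w
    simp only [tangentInner, form]
    linear_combination (-(u 1 * w 1 + u 2 * w 2)) * hs
  have e2 : form κ (direction p q) (direction p r) = form κ q.coords r.coords -
      2 * (form κ p.coords q.coords * form κ p.coords r.coords) +
      form κ p.coords q.coords * form κ p.coords r.coords * form κ p.coords p.coords := by
    simp only [direction]
    generalize hb : form κ p.coords q.coords = b
    generalize hc : form κ p.coords r.coords = c
    simp only [form, Pi.sub_apply, Pi.smul_apply, smul_eq_mul] at hb hc ⊢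
    linear_combination (-c) * hb - b * hc
  rw [e, e2, hp]
  ring

/-- The Gram determinant of the two sides at `p` is the square of the triple product. -/
theorem gram_direction {κ : ℝ} (p q r : ModelPlane κ) :
    tangentInner κ (direction p q) (direction p q) * tangentInner κ (direction p r) (direction p r) -
      tangentInner κ (direction p q) (direction p r) ^ 2 =
    tripleProduct p.coords q.coords r.coords ^ 2 := by
  rcases eq_or_ne κ 0 with rfl | hκ
  · have h1 := form_zero p q
    have h2 := form_zero p r
    simp only [direction, h1, h2, tangentInner, tripleProduct, Real.sign_zero, Pi.sub_apply,
      Pi.smul_apply, coords_zero_eq_one, smul_eq_mul]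
    ring
  · have hs : Real.sign κ * Real.sign κ = 1 := by
      rcases lt_or_gt_of_ne hκ with h | h
      · simp [Real.sign_of_neg h]
      · simp [Real.sign_of_pos h]
    -- The Gram determinant of `form` at the three points is `sign² · det²`. As `form p p = 1`,
    -- eliminating `p` leaves the 2×2 Gram determinant of the directions.
    have hG : form κ p.coords p.coords * (form κ q.coords q.coords * form κ r.coords r.coords -
        form κ q.coords r.coords ^ 2) - form κ p.coords q.coords * (form κ p.coords q.coords *
        form κ r.coords r.coords - form κ q.coords r.coords * form κ p.coords r.coords) +
        form κ p.coords r.coords * (form κ p.coords q.coords * form κ q.coords r.coords -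
        form κ q.coords q.coords * form κ p.coords r.coords) =
        Real.sign κ * Real.sign κ * tripleProduct p.coords q.coords r.coords ^ 2 := by
      simp only [form, tripleProduct]
      ring
    simp only [tangentInner_direction hκ]
    simp only [form_self] at hG ⊢
    linear_combination hG + (1 - form κ p.coords q.coords ^ 2 - form κ p.coords r.coords ^ 2
      - form κ q.coords r.coords ^ 2 + 2 * form κ p.coords q.coords * form κ p.coords r.coords *
        form κ q.coords r.coords + tripleProduct p.coords q.coords r.coords ^ 2) * hs

/-- Projection to the tangent plane kills `p`, so `direction p q` is `h q` times the projection of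
the chart difference `v`, hence `O(d)`. -/
theorem IsBounded.tangentInner_direction_le {κ H R d : ℝ} {h : (Fin 3 → ℝ) →ₗ[ℝ] ℝ}
    {p q : ModelPlane κ} (hp : IsBounded h H R p) (hq : IsBounded h H R q)
    (hpq : ‖chart h p - chart h q‖ ≤ d) :
    tangentInner κ (direction p q) (direction p q) ≤
      3 * (H * (1 + 3 * (H * R) ^ 2)) ^ 2 * d ^ 2 := by
  have hd : 0 ≤ d := (norm_nonneg _).trans hpq
  have hR : 0 ≤ R := (norm_nonneg _).trans hp.norm_le
  have hH : 0 ≤ H := hp.pos.le.trans hp.le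
  set v := chart h q - chart h p with hv
  have hvd : ‖v‖ ≤ d := by rwa [hv, norm_sub_rev]
  have hpn : ‖p.coords‖ ≤ H * R := by
    rw [← smul_chart hp.pos, norm_smul, Real.norm_of_nonneg hp.pos.le]
    exact mul_le_mul hp.le hp.norm_le (norm_nonneg _) hH
  have e : direction p q = h q.coords • (v - form κ p.coords v • p.coords) := by
    have hself := form_self p
    have e1 : q.coords = h q.coords • v + (h q.coords * (h p.coords)⁻¹) • p.coords := by
      rw [hv, smul_sub, smul_chart hq.pos, chart, smul_smul]
      simp
    have e2 : form κ p.coords q.coords =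
        h q.coords * form κ p.coords v + h q.coords * (h p.coords)⁻¹ := by
      have : form κ p.coords (h q.coords • v + (h q.coords * (h p.coords)⁻¹) • p.coords) =
          h q.coords * form κ p.coords v +
            h q.coords * (h p.coords)⁻¹ * form κ p.coords p.coords := by
        simp only [form, Pi.add_apply, Pi.smul_apply, smul_eq_mul]
        ring
      rw [← e1, hself, mul_one] at this
      exact this
    rw [direction, e2]
    nth_rewrite 1 [e1]
    module
  have hn : ‖direction p q‖ ≤ H * (1 + 3 * (H * R) ^ 2) * d := by
    rw [e, norm_smul, Real.norm_of_nonneg hq.pos.le, mul_assoc]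
    refine mul_le_mul hq.le ?_ (norm_nonneg _) hH
    have h1 : ‖form κ p.coords v • p.coords‖ ≤ 3 * ((H * R) * d) * (H * R) := by
      rw [norm_smul]
      refine mul_le_mul ((abs_form_le _ _ _).trans ?_) hpn (norm_nonneg _) (by positivity)
      gcongr
    refine (norm_sub_le _ _).trans ?_
    linarith
  calc tangentInner κ (direction p q) (direction p q)
      ≤ 3 * (‖direction p q‖ * ‖direction p q‖) := le_of_abs_le (abs_tangentInner_le _ _ _)
    _ ≤ 3 * ((H * (1 + 3 * (H * R) ^ 2) * d) * (H * (1 + 3 * (H * R) ^ 2) * d)) := by gcongr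
    _ = _ := by ring

theorem angle_mem_Icc {κ η : ℝ} {p q r : ModelPlane κ}
    (h : 0 < tangentInner κ (direction p q) (direction p q) →
      0 < tangentInner κ (direction p r) (direction p r) →
      η * (tangentInner κ (direction p q) (direction p q) *
        tangentInner κ (direction p r) (direction p r)) ≤
      tripleProduct p.coords q.coords r.coords ^ 2) :
    angle q p r ∈ Set.Icc (Real.arccos √(1 - η)) (Real.pi - Real.arccos √(1 - η)) := by
  have hG := gram_direction p q r
  rw [angle]
  set a := tangentInner κ (direction p q) (direction p q)
  set b := tangentInner κ (direction p r) (direction p r)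
  set i := tangentInner κ (direction p q) (direction p r)
  have key : |i / (√a * √b)| ≤ √(1 - η) := by
    -- If a self-product is not positive, its `√` is 0 and the quotient takes the default value 0,
    -- which satisfies the bound.
    rcases le_or_gt a 0 with ha | ha
    · simp [Real.sqrt_eq_zero_of_nonpos ha]
    rcases le_or_gt b 0 with hb | hb
    · simp [Real.sqrt_eq_zero_of_nonpos hb]
    refine Real.abs_le_sqrt ?_
    rw [div_pow, mul_pow, Real.sq_sqrt ha.le, Real.sq_sqrt hb.le, div_le_iff₀ (by positivity)]
    linarith [h ha hb]
  obtain ⟨h1, h2⟩ := abs_le.1 key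
  refine ⟨Real.arccos_le_arccos h2, ?_⟩
  rw [← Real.arccos_neg]
  exact Real.arccos_le_arccos h1

theorem IsBounded.sq_tripleProduct_chart_le {κ H R : ℝ} {h : (Fin 3 → ℝ) →ₗ[ℝ] ℝ}
    {p q r : ModelPlane κ} (hp : IsBounded h H R p) (hq : IsBounded h H R q)
    (hr : IsBounded h H R r) :
    tripleProduct (chart h p) (chart h q) (chart h r) ^ 2 ≤
      27 * R ^ 6 * tripleProduct p.coords q.coords r.coords ^ 2 := by
  have e : tripleProduct p.coords q.coords r.coords = h p.coords * h q.coords * h r.coords *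
      tripleProduct (chart h p) (chart h q) (chart h r) := by
    rw [← tripleProduct_smul, smul_chart hp.pos, smul_chart hq.pos, smul_chart hr.pos]
  have h1 : 1 * 1 * 1 ≤ (3 * R ^ 2 * h p.coords ^ 2) * (3 * R ^ 2 * h q.coords ^ 2) *
      (3 * R ^ 2 * h r.coords ^ 2) := by
    have := hp.one_le
    have := hq.one_le
    have := hr.one_le
    gcongr
  rw [e]
  calc _ = 1 * 1 * 1 * tripleProduct (chart h p) (chart h q) (chart h r) ^ 2 := by ring
    _ ≤ _ := mul_le_mul_of_nonneg_right h1 (sq_nonneg _)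
    _ = _ := by ring

theorem IsBounded.angle_mem_Icc {κ H R c d : ℝ} {h : (Fin 3 → ℝ) →ₗ[ℝ] ℝ} {p q r : ModelPlane κ}
    (hp : IsBounded h H R p) (hq : IsBounded h H R q) (hr : IsBounded h H R r) (hc : 0 < c)
    (hpq : ‖chart h p - chart h q‖ ≤ d) (hpr : ‖chart h p - chart h r‖ ≤ d)
    (hD : c * d ^ 2 ≤ |tripleProduct (chart h p) (chart h q) (chart h r)|) :
    angle q p r ∈ Set.Icc
      (Real.arccos √(1 - c ^ 2 / (c ^ 2 + 27 * R ^ 6 * (3 * (H * (1 + 3 * (H * R) ^ 2)) ^ 2) ^ 2)))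
      (Real.pi - Real.arccos
        √(1 - c ^ 2 / (c ^ 2 + 27 * R ^ 6 * (3 * (H * (1 + 3 * (H * R) ^ 2)) ^ 2) ^ 2))) := by
  set M := 3 * (H * (1 + 3 * (H * R) ^ 2)) ^ 2 with hM
  have hM0 : 0 ≤ M := by positivity
  have hR : 0 < R ^ 6 := by
    have h1 := hp.one_le
    have hR0 : R ≠ 0 := by
      rintro rfl
      norm_num at h1
    positivity
  refine ModelPlane.angle_mem_Icc fun ha hb => ?_
  have h1 : tangentInner κ (direction p q) (direction p q) *
      tangentInner κ (direction p r) (direction p r) ≤ (M * d ^ 2) * (M * d ^ 2) :=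
    mul_le_mul (hp.tangentInner_direction_le hq hpq) (hp.tangentInner_direction_le hr hpr) hb.le
      (by positivity)
  have h2 : (c * d ^ 2) ^ 2 ≤ 27 * R ^ 6 * tripleProduct p.coords q.coords r.coords ^ 2 := by
    refine le_trans ?_ (hp.sq_tripleProduct_chart_le hq hr)
    rw [← sq_abs (tripleProduct (chart h p) (chart h q) (chart h r))]
    gcongr
  set D := tripleProduct p.coords q.coords r.coords
  rw [div_mul_eq_mul_div, div_le_iff₀ (by positivity)]
  calc _ ≤ c ^ 2 * ((M * d ^ 2) * (M * d ^ 2)) := by gcongr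
    _ = M ^ 2 * (c * d ^ 2) ^ 2 := by ring
    _ ≤ M ^ 2 * (27 * R ^ 6 * D ^ 2) := by gcongr
    _ ≤ D ^ 2 * (c ^ 2 + 27 * R ^ 6 * M ^ 2) := by
      linarith [show 0 ≤ D ^ 2 * c ^ 2 by positivity]

/-- There is a linear functional that is positive at the vertices of `T`, with an upper bound at the
vertices that passes to midpoints. -/
theorem exists_pos_functional {κ : ℝ} (T : GeodesicTriangle κ) (hemi : 0 < κ → T.InOpenHemisphere) :
    ∃ (h : (Fin 3 → ℝ) →ₗ[ℝ] ℝ) (H : ℝ),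
      (0 < h T.A.coords ∧ h T.A.coords ≤ H) ∧ (0 < h T.B.coords ∧ h T.B.coords ≤ H) ∧
      (0 < h T.C.coords ∧ h T.C.coords ≤ H) ∧
      ∀ p q m : ModelPlane κ, h p.coords ≤ H → h q.coords ≤ H → IsMidpoint p q m →
        h m.coords ≤ H := by
  rcases le_or_gt κ 0 with hκ | hκ
  · refine ⟨LinearMap.proj 0, max (T.A.coords 0) (max (T.B.coords 0) (T.C.coords 0)),
      ⟨T.A.positive hκ, le_max_left _ _⟩,
      ⟨T.B.positive hκ, (le_max_left _ _).trans (le_max_right _ _)⟩,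
      ⟨T.C.positive hκ, (le_max_right _ _).trans (le_max_right _ _)⟩, ?_⟩
    intro p q m hp hq hm
    generalize max (T.A.coords 0) (max (T.B.coords 0) (T.C.coords 0)) = H at hp hq ⊢
    simp only [LinearMap.proj_apply] at hp hq ⊢
    have hf := one_le_form_of_nonpos hκ p q
    rw [hm.coords_eq (by linarith)]
    -- The normalizing factor is at least 2, so `h` at the midpoint is at most the mean of its
    -- values at the endpoints.
    have ht : 2 ≤ √(2 + 2 * form κ p.coords q.coords) :=
      Real.le_sqrt_of_sq_le (by linarith)
    have h0 := p.positive hκ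
    simp only [Pi.smul_apply, Pi.add_apply, smul_eq_mul]
    rw [inv_mul_le_iff₀ (by linarith)]
    nlinarith
  · obtain ⟨c, hA, hB, hC⟩ := hemi hκ
    have hs : 0 < √κ := Real.sqrt_pos.2 hκ
    have pos : ∀ p : ModelPlane κ, dist c p < Real.pi / (2 * √κ) →
        0 < form κ c.coords p.coords := by
      intro p hp
      simp only [dist, hκ, if_true] at hp
      rw [← div_div, div_lt_div_iff_of_pos_right hs, Real.arccos_lt_pi_div_two] at hp
      exact hp
    have le : ∀ p : ModelPlane κ, form κ c.coords p.coords ≤ 1 := fun p =>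
      le_of_abs_le (abs_form_le_one_of_pos hκ c p)
    -- The product with the centre of the hemisphere is a cosine: positive inside the hemisphere and
    -- at most 1 everywhere.
    let h : (Fin 3 → ℝ) →ₗ[ℝ] ℝ :=
      { toFun := form κ c.coords
        map_add' := fun x y => by simp only [form, Pi.add_apply]; ring
        map_smul' := fun a x => by
          simp only [form, Pi.smul_apply, smul_eq_mul, RingHom.id_apply]; ring }
    exact ⟨h, 1, ⟨pos _ hA, le _⟩, ⟨pos _ hB, le _⟩, ⟨pos _ hC, le _⟩, fun _ _ m _ _ _ => le m⟩

end ModelPlane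

namespace GeodesicTriangle

open ModelPlane

/-! ### Control of all triangles of the subdivisions -/

/-- The vertices of `t` are bounded, and in the chart the area of `t` is bounded below by a
constant multiple of the square of a bound `d` for the lengths of the sides, with an exponential
factor that makes this bound hereditary under medial subdivision. -/
structure IsControlled {κ : ℝ} (h : (Fin 3 → ℝ) →ₗ[ℝ] ℝ) (H R c d₀ : ℝ) (t : GeodesicTriangle κ) :
    Prop where
  A : IsBounded h H R t.A
  B : IsBounded h H R t.B
  C : IsBounded h H R t.C
  exists_bound : ∃ d : ℝ, 0 < d ∧ d ≤ d₀ ∧ ‖chart h t.A - chart h t.B‖ ≤ d ∧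
    ‖chart h t.B - chart h t.C‖ ≤ d ∧ ‖chart h t.C - chart h t.A‖ ≤ d ∧
    c * d ^ 2 * Real.exp (3 * (2 + 6 * R * H ^ 2 * d₀) * (6 * R * H ^ 2 * d)) ≤
      |tripleProduct (chart h t.A) (chart h t.B) (chart h t.C)|

theorem IsControlled.medialPart {κ H R c d₀ : ℝ} {h : (Fin 3 → ℝ) →ₗ[ℝ] ℝ}
    {T t : GeodesicTriangle κ} (hc : 0 ≤ c)
    (hmid : ∀ p q m : ModelPlane κ, h p.coords ≤ H → h q.coords ≤ H → IsMidpoint p q m →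
      h m.coords ≤ H)
    (hT : IsControlled h H R c d₀ T) (ht : T.IsMedialPart t) : IsControlled h H R c d₀ t := by
  obtain ⟨hA, hB, hC, d, hd, hd₀, hAB, hBC, hCA, hD⟩ := hT
  obtain ⟨X, Y, Z, hXm, hYm, hZm, ht⟩ := ht
  have hR : 0 ≤ R := (norm_nonneg _).trans hA.norm_le
  have hK : 0 ≤ 6 * R * H ^ 2 := by positivity
  have hstep := shape_bound_step hK hc hd hd₀
  obtain ⟨hX0, hX⟩ := hB.isBalanced hC hBC hXm
  obtain ⟨hY0, hY⟩ := hC.isBalanced hA hCA hYm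
  obtain ⟨hZ0, hZ⟩ := hA.isBalanced hB hAB hZm
  have hKd : 0 ≤ 6 * R * H ^ 2 * d := by positivity
  set m := 1 / (2 + 6 * R * H ^ 2 * d) with hm
  have hm0 : 0 < m := by positivity
  have hm2 : m ≤ 1 / 2 := by
    rw [hm]
    gcongr
    linarith
  have bX : IsBounded h H R X := ⟨hX0, hmid _ _ _ hB.le hC.le hXm,
    hX.norm_le hm0.le hB.norm_le hC.norm_le⟩
  have bY : IsBounded h H R Y := ⟨hY0, hmid _ _ _ hC.le hA.le hYm,
    hY.norm_le hm0.le hC.norm_le hA.norm_le⟩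
  have bZ : IsBounded h H R Z := ⟨hZ0, hmid _ _ _ hA.le hB.le hZm,
    hZ.norm_le hm0.le hA.norm_le hB.norm_le⟩
  have hBA := hAB
  have hCB := hBC
  have hAC := hCA
  rw [norm_sub_rev] at hBA hCB hAC
  have hd' : 0 < (1 - m) * d := mul_pos (by linarith) hd
  have hd'₀ : (1 - m) * d ≤ d₀ := by nlinarith
  have area : ∀ {D : ℝ}, 2 * m ^ 3 *
      |tripleProduct (chart h T.A) (chart h T.B) (chart h T.C)| ≤ D →
      c * ((1 - m) * d) ^ 2 *
        Real.exp (3 * (2 + 6 * R * H ^ 2 * d₀) * (6 * R * H ^ 2 * ((1 - m) * d))) ≤ D :=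
    fun hD' => (hstep.trans (mul_le_mul_of_nonneg_left hD (by positivity))).trans hD'
  have dZY := hZ.norm_sub_le hm0.le hY.symm hAB hAC hBC
  have dXZ := hX.norm_sub_le hm0.le hZ.symm hBC hBA hCA
  have dYX := hY.norm_sub_le hm0.le hX.symm hCA hCB hAB
  have dAZ := hZ.norm_sub_left_le hm0.le hAB
  have dBZ := hZ.symm.norm_sub_left_le hm0.le hBA
  have dBX := hX.norm_sub_left_le hm0.le hBC
  have dCX := hX.symm.norm_sub_left_le hm0.le hCB
  have dCY := hY.norm_sub_left_le hm0.le hCA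
  have dAY := hY.symm.norm_sub_left_le hm0.le hAC
  rcases ht with rfl | rfl | rfl | rfl
  · exact ⟨hA, bZ, bY, _, hd', hd'₀, dAZ, dZY, by rwa [norm_sub_rev],
      area (hZ.abs_tripleProduct_corner hm0.le hm2 hY.symm)⟩
  · refine ⟨bZ, hB, bX, _, hd', hd'₀, by rwa [norm_sub_rev], dBX, dXZ, area ?_⟩
    -- Cyclic rotation brings the vertex kept from `T` to the front, as the corner estimate
    -- requires.
    rw [← tripleProduct_rotate, ← tripleProduct_rotate (chart h Z)]
    exact hX.abs_tripleProduct_corner hm0.le hm2 hZ.symm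
  · refine ⟨bY, bX, hC, _, hd', hd'₀, dYX, by rwa [norm_sub_rev], dCY, area ?_⟩
    rw [tripleProduct_rotate (chart h T.C) (chart h T.A), tripleProduct_rotate (chart h T.C)]
    exact hY.abs_tripleProduct_corner hm0.le hm2 hX.symm
  · exact ⟨bX, bY, bZ, _, hd', hd'₀, by rwa [norm_sub_rev], by rwa [norm_sub_rev],
      by rwa [norm_sub_rev], area (IsBalanced.abs_tripleProduct_center hm0.le hX hY hZ)⟩

theorem IsControlled.exists_angle_bound {κ H R c d₀ : ℝ} {h : (Fin 3 → ℝ) →ₗ[ℝ] ℝ} (hc : 0 < c) :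
    ∃ δ : ℝ, 0 < δ ∧ ∀ t : GeodesicTriangle κ, IsControlled h H R c d₀ t →
      ∀ θ : ℝ, t.HasAngle θ → θ ∈ Set.Ioo δ (Real.pi - δ) := by
  set η := c ^ 2 / (c ^ 2 + 27 * R ^ 6 * (3 * (H * (1 + 3 * (H * R) ^ 2)) ^ 2) ^ 2) with hη
  have hR6 : 0 ≤ R ^ 6 := by positivity
  -- The summand `c ^ 2` in the denominator gives positivity without knowing that `R` or `H` is
  -- nonzero.
  have hη0 : 0 < η := by positivity
  have hα : 0 < Real.arccos √(1 - η) := by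
    rw [Real.arccos_pos, Real.sqrt_lt' one_pos]
    linarith
  -- Halving places the closed interval of angles inside an open one.
  refine ⟨Real.arccos √(1 - η) / 2, by linarith, fun t ht θ hθ => ?_⟩
  suffices hI : θ ∈ Set.Icc (Real.arccos √(1 - η)) (Real.pi - Real.arccos √(1 - η)) from
    ⟨by linarith [hI.1], by linarith [hI.2]⟩
  obtain ⟨hA, hB, hC, d, hd, hd₀, hAB, hBC, hCA, hD⟩ := ht
  have hBA := hAB
  have hCB := hBC
  have hAC := hCA
  rw [norm_sub_rev] at hBA hCB hAC
  have hR : 0 ≤ R := (norm_nonneg _).trans hA.norm_le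
  have hd₀' : 0 ≤ d₀ := hd.le.trans hd₀
  have hD' : c * d ^ 2 ≤ |tripleProduct (chart h t.A) (chart h t.B) (chart h t.C)| := by
    refine le_trans ?_ hD
    exact le_mul_of_one_le_right (by positivity) (Real.one_le_exp (by positivity))
  rcases hθ with rfl | rfl | rfl
  · exact hA.angle_mem_Icc hB hC hc hAB hAC hD'
  · exact hB.angle_mem_Icc hC hA hc hBC hBA (by rwa [tripleProduct_rotate])
  · exact hC.angle_mem_Icc hA hB hc hCA hCB (by rwa [← tripleProduct_rotate])

theorem IsNondegenerate.exists_isControlled {κ H : ℝ} {h : (Fin 3 → ℝ) →ₗ[ℝ] ℝ}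
    {T : GeodesicTriangle κ} (hT : T.IsNondegenerate)
    (hA : 0 < h T.A.coords ∧ h T.A.coords ≤ H) (hB : 0 < h T.B.coords ∧ h T.B.coords ≤ H)
    (hC : 0 < h T.C.coords ∧ h T.C.coords ≤ H) :
    ∃ R c d₀ : ℝ, 0 < c ∧ IsControlled h H R c d₀ T := by
  set R := max ‖chart h T.A‖ (max ‖chart h T.B‖ ‖chart h T.C‖) with hR
  -- The perimeter bounds every side; the summand 1 makes positivity immediate.
  set d₀ := 1 + ‖chart h T.A - chart h T.B‖ + ‖chart h T.B - chart h T.C‖ +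
    ‖chart h T.C - chart h T.A‖ with hd₀
  have n1 := norm_nonneg (chart h T.A - chart h T.B)
  have n2 := norm_nonneg (chart h T.B - chart h T.C)
  have n3 := norm_nonneg (chart h T.C - chart h T.A)
  have hd₀0 : 0 < d₀ := by linarith
  have hD : 0 < |tripleProduct (chart h T.A) (chart h T.B) (chart h T.C)| := by
    rw [abs_pos, chart, chart, chart, tripleProduct_smul]
    have := hA.1
    have := hB.1
    have := hC.1
    exact mul_ne_zero (by positivity) (tripleProduct_ne_zero hT)
  set e := d₀ ^ 2 * Real.exp (3 * (2 + 6 * R * H ^ 2 * d₀) * (6 * R * H ^ 2 * d₀)) with he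
  have he0 : 0 < e := by positivity
  -- The constant `c` is chosen so that the area bound is an equality for `T` at `d = d₀`.
  refine ⟨R, |tripleProduct (chart h T.A) (chart h T.B) (chart h T.C)| / e, d₀, by positivity,
    ⟨hA.1, hA.2, le_max_left _ _⟩, ⟨hB.1, hB.2, (le_max_left _ _).trans (le_max_right _ _)⟩,
    ⟨hC.1, hC.2, (le_max_right _ _).trans (le_max_right _ _)⟩, d₀, hd₀0, le_rfl, by linarith,
    by linarith, by linarith, ?_⟩
  rw [mul_assoc, ← he, div_mul_cancel₀ _ he0.ne']

end GeodesicTriangle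

theorem theoremA (κ : ℝ) (T : GeodesicTriangle κ) (hT : T.IsNondegenerate)
    (hemi : 0 < κ → T.InOpenHemisphere) :
    ∃ δ : ℝ, 0 < δ ∧ ∀ n : ℕ, ∀ t ∈ T.subdivision n, ∀ θ : ℝ, t.HasAngle θ →
      θ ∈ Set.Ioo δ (Real.pi - δ) := by
  obtain ⟨h, H, hA, hB, hC, hmid⟩ := ModelPlane.exists_pos_functional T hemi
  obtain ⟨R, c, d₀, hc, hcontrol⟩ := hT.exists_isControlled hA hB hC
  obtain ⟨δ, hδ, hangle⟩ :=
    GeodesicTriangle.IsControlled.exists_angle_bound (κ := κ) (h := h) (H := H) (R := R)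
      (d₀ := d₀) hc
  refine ⟨δ, hδ, fun n t ht => hangle t ?_⟩
  induction n generalizing t with
  | zero =>
    rw [show t = T from ht]
    exact hcontrol
  | succ n ih =>
    obtain ⟨s, hs, hst⟩ := ht
    exact (ih s hs).medialPart hc.le hmid hst
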